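/- Let $c,n,m\ge 0$ be integers, $E,A\in\mathbb{R}^{c\times n}$, $B\in\mathbb{R}^{c\times m}$, and consider the DAE-LTI $$\frac{d\,Ex(t)}{dt}=Ax(t)+Bu(t).\qquad(1)$$ **Intervals and function spaces.** An interval is a set $I$ of one of the forms $\mathbb{R}$, $[a,+\infty)$, $(-\infty,a]$, $[a,b]$ with $a<b$. $L^1_{loc}(I,\mathbb{R}^k)$ is the set of measurable functions $I\to\mathbb{R}^k$ that are Lebesgue integrable on every compact subinterval of $I$, and $AC(I,\mathbb{R}^k)$ is the set of functions $I\to\mathbb{R}^k$ that are absolutely continuous on every compact subinterval of $I$. **Solutions.** A solution of (1) on $I$ is a pair $(x,u)\in L^1_{loc}(I,\mathbb{R}^n)\times L^1_{loc}(I,\mathbb{R}^m)$ such that $Ex\in AC(I,\mathbb{R}^c)$ and $Ex(t)=Ex(t_0)+\int_{t_0}^t(Ax(s)+Bu(s))\,ds$ for all $t_0,t\in I$ with $t\ge t_0$. The set of all solutions on $I$ is denoted $\mathcal{B}_I(E,A,B)$ and is viewed as a subset of $L^1_{loc}(I,\mathbb{R}^{n+m})$. **Associated ODE-LTIs.** An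 ODE-LTI associated with (1) is a quadruple of matrices $(A_l,B_l,C_l,D_l)$, $A_l\in\mathbb{R}^{\hat n\times\hat n}$, $B_l\in\mathbb{R}^{\hat n\times k}$, $C_l\in\mathbb{R}^{(n+m)\times\hat n}$, $D_l\in\mathbb{R}^{(n+m)\times k}$, with $0\le\hat n\le n$ and $k\ge 1$, such that: 1. either $D_l=0$, $B_l=0$ and $k=1$, or $\operatorname{rank}D_l=k$; 2. if $C_s$ and $D_s$ are the matrices formed by the first $n$ rows of $C_l$ and $D_l$, then $ED_s=0$ and $\operatorname{rank}EC_s=\hat n$; 3. for every interval $I$, $(A_l,B_l,C_l,D_l)$ is a realization of $\mathcal{B}_I(E,A,B)$, that is: (a) for every $z\in\mathcal{B}_I(E,A,B)$ there are $v\in AC(I,\mathbb{R}^{\hat n})$ and $g\in L^1_{loc}(I,\mathbb{R}^k)$ with $\dot v=A_lv+B_lg$ a.e. and $z=C_lv+D_lg$ a.e. on $I$; and (b) whenever $v\in AC(I,\mathbb{R}^{\hat n})$ and $g\in L^1_{loc}(I,\mathbb{R}^k)$ satisfy $\dot v=A_lv+B_lg$ a.e. on $I$, there is $z\in\mathcal{B}_I(E,A,B)$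 with $z=C_lv+D_lg$ a.e. on $I$. **Theorem.** Any two ODE-LTIs $(A_1,B_1,C_1,D_1)$ and $(A_2,B_2,C_2,D_2)$ associated with the same DAE-LTI (1) are feedback equivalent: they have the same number of states $\hat n$ and the same number of inputs $k$, and there exist a matrix $K\in\mathbb{R}^{k\times\hat n}$ and nonsingular matrices $T\in\mathbb{R}^{\hat n\times\hat n}$, $U\in\mathbb{R}^{k\times k}$ such that $$\bigl(T(A_1+B_1K)T^{-1},\;TB_1U,\;(C_1+D_1K)T^{-1},\;D_1U\bigr)=(A_2,B_2,C_2,D_2).$$ -/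

import Mathlib

open MeasureTheory Matrix

namespace DAELTI

/-- The intervals under consideration: `ℝ`, `[a, ∞)`, `(-∞, a]` and `[a, b]` with `a < b`. -/
def IsTimeInterval (I : Set ℝ) : Prop :=
  I = Set.univ ∨ (∃ a, I = Set.Ici a) ∨ (∃ a, I = Set.Iic a) ∨ ∃ a b, a < b ∧ I = Set.Icc a b

/-- `f ∈ AC(I, ℝ^ι)`: `f` is absolutely continuous on every compact subinterval of `I`. Functions
on `I` are represented by functions on `ℝ`; their values outside `I` play no role. -/
def IsAC {ι : Type*} [Fintype ι] (I : Set ℝ) (f : ℝ → ι → ℝ) : Prop :=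
  ∀ a b : ℝ, a ≤ b → Set.Icc a b ⊆ I → AbsolutelyContinuousOnInterval f a b

/-- `f ∈ L¹_loc(I, ℝ^ι)`: `f` is (Lebesgue) integrable on every compact subinterval of `I`. -/
def IsL1loc {ι : Type*} [Fintype ι] (I : Set ℝ) (f : ℝ → ι → ℝ) : Prop :=
  ∀ a b : ℝ, a ≤ b → Set.Icc a b ⊆ I → IntegrableOn f (Set.Icc a b) volume

/-- `(x, u)` is a solution on `I` of the differential-algebraic system `d(Ex)/dt = Ax + Bu`. -/
structure IsSolution {c n m : ℕ} (E A : Matrix (Fin c) (Fin n) ℝ) (B : Matrix (Fin c) (Fin m) ℝ)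
    (I : Set ℝ) (x : ℝ → Fin n → ℝ) (u : ℝ → Fin m → ℝ) : Prop where
  l1_x : IsL1loc I x
  l1_u : IsL1loc I u
  ac : IsAC I (fun t => E *ᵥ x t)
  eq : ∀ t₀ ∈ I, ∀ t ∈ I, t₀ ≤ t →
    E *ᵥ x t = E *ᵥ x t₀ + ∫ s in t₀..t, (A *ᵥ x s + B *ᵥ u s)

/-- The behavior `𝓑_I(E, A, B)`: the solutions on `I`, viewed as functions with values in
`ℝⁿ × ℝᵐ`, whose coordinates are indexed by `Fin n ⊕ Fin m`. -/
def behavior {c n m : ℕ} (E A : Matrix (Fin c) (Fin n) ℝ) (B : Matrix (Fin c) (Fin m) ℝ)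
    (I : Set ℝ) : Set (ℝ → Fin n ⊕ Fin m → ℝ) :=
  {z | IsSolution E A B I (fun t i => z t (Sum.inl i)) (fun t j => z t (Sum.inr j))}

/-- A linear time-invariant system `p' = A p + B q`, `z = C p + D q` with output coordinates
indexed by `ι`, `states` state variables and `inputs` input variables. -/
structure ODELTI (ι : Type*) where
  states : ℕ
  inputs : ℕ
  A : Matrix (Fin states) (Fin states) ℝ
  B : Matrix (Fin states) (Fin inputs) ℝ
  C : Matrix ι (Fin states) ℝ
  D : Matrix ι (Fin inputs) ℝ

namespace ODELTI

/-- `(p, q) ∈ AC × L¹_loc` and `p' = A p + B q` almost everywhere on `I`. -/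
structure IsTrajectory {ι : Type*} (S : ODELTI ι) (I : Set ℝ)
    (p : ℝ → Fin S.states → ℝ) (q : ℝ → Fin S.inputs → ℝ) : Prop where
  ac : IsAC I p
  l1 : IsL1loc I q
  deriv : ∀ᵐ t ∂(volume.restrict I), HasDerivWithinAt p (S.A *ᵥ p t + S.B *ᵥ q t) I t

/-- The output `C p + D q`. -/
def output {ι : Type*} (S : ODELTI ι) (p : ℝ → Fin S.states → ℝ)
    (q : ℝ → Fin S.inputs → ℝ) : ℝ → ι → ℝ :=
  fun t => S.C *ᵥ p t + S.D *ᵥ q t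

/-- `S` is a realization of the set `𝓑` of functions on `I`: up to null sets, the output
trajectories of `S` on `I` are the elements of `𝓑`. -/
def IsRealization {ι : Type*} (S : ODELTI ι) (I : Set ℝ) (𝓑 : Set (ℝ → ι → ℝ)) : Prop :=
  (∀ z ∈ 𝓑, ∃ p q, S.IsTrajectory I p q ∧ z =ᵐ[volume.restrict I] S.output p q) ∧
  (∀ p q, S.IsTrajectory I p q → ∃ z ∈ 𝓑, z =ᵐ[volume.restrict I] S.output p q)

/-- `S` is an ODE-LTI associated with the DAE-LTI `d(Ex)/dt = Ax + Bu`. Here `S.C.toRows₁` and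
`S.D.toRows₁` consist of the first `n` rows of `S.C` and `S.D`. -/
structure IsAssociated {c n m : ℕ} (S : ODELTI (Fin n ⊕ Fin m))
    (E A : Matrix (Fin c) (Fin n) ℝ) (B : Matrix (Fin c) (Fin m) ℝ) : Prop where
  states_le : S.states ≤ n
  inputs_pos : 1 ≤ S.inputs
  input_cond : (S.D = 0 ∧ S.B = 0 ∧ S.inputs = 1) ∨ S.D.rank = S.inputs
  mul_D : E * S.D.toRows₁ = 0
  rank_mul_C : (E * S.C.toRows₁).rank = S.states
  realization : ∀ I, IsTimeInterval I → S.IsRealization I (behavior E A B I)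

/-- Feedback equivalence: `S₂ = (T(A₁ + B₁K)T⁻¹, TB₁U, (C₁ + D₁K)T⁻¹, D₁U)` for some matrix `K` and
nonsingular `T`, `U`. The equality includes equality of the numbers of states and of inputs. -/
def FeedbackEquivalent {ι : Type*} (S₁ S₂ : ODELTI ι) : Prop :=
  ∃ (T : Matrix (Fin S₁.states) (Fin S₁.states) ℝ)
    (K : Matrix (Fin S₁.inputs) (Fin S₁.states) ℝ)
    (U : Matrix (Fin S₁.inputs) (Fin S₁.inputs) ℝ),
    IsUnit T ∧ IsUnit U ∧
    S₂ = { states := S₁.states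
           inputs := S₁.inputs
           A := T * (S₁.A + S₁.B * K) * T⁻¹
           B := T * S₁.B * U
           C := (S₁.C + S₁.D * K) * T⁻¹
           D := S₁.D * U }

end ODELTI

end DAELTI

/-!
The idea is to compare the trajectories of the two systems that share an output.

Write `F i = E * (S i).C.toRows₁`. Since `E * (S i).D.toRows₁ = 0`, applying `E` to the first `n`
coordinates of an output of `S i` gives `F i *ᵥ p`. The matrix `F i` has full column rank, so the
state is determined by the output. Start `S₁` at an arbitrary state `x` with a constant input `g`;
on a short interval `[0, δ]` the resulting output is an output of `S₂`, for some trajectory `(p₂, q₂)`.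
Then `F₁ p₁ = F₂ p₂`, hence `p₂ = T p₁` with `T = F₂⁺ F₁`, where `F₂⁺` is a left inverse of `F₂`.
The equality of the outputs expresses `D₂ q₂` through `p₁` and `g`, and the input condition makes
`B₂ q₂` a function of `D₂ q₂`. All the relations obtained hold almost everywhere and have continuous
sides, so they hold at `t = 0`, that is, for the arbitrary pair `(x, g)`. They say that

  `F₁ = F₂ T`,  `C₁ = C₂ T + D₂ W`,  `D₁ = D₂ V`,  `T A₁ = A₂ T + B₂ W`,  `T B₁ = B₂ V`

for matrices `W`, `V` (`IsAssociated.exists_intertwining`). Exchanging the systems yields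
`F₂ = F₁ T'` and `D₂ = D₁ V'`. By injectivity of the `F i`, the matrix `T` is invertible; if the
`D i` have full column rank, so is `V`, and if they vanish one may take `V = 1`, `W = 0`. Solving
the five equations for `S₂` is the asserted feedback equivalence, with `K = -V⁻¹ W` and `U = V⁻¹`.
-/

namespace DAELTI

/-! ### Matrices of full column rank -/

theorem exists_mul_eq_one_of_rank_eq {ι : Type*} [Fintype ι] {k : ℕ} (M : Matrix ι (Fin k) ℝ)
    (h : M.rank = k) : ∃ N : Matrix (Fin k) ι ℝ, N * M = 1 := by
  classical
  have hker : LinearMap.ker M.mulVecLin = ⊥ := by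
    have h1 := LinearMap.finrank_range_add_finrank_ker M.mulVecLin
    rw [← Matrix.rank, h] at h1
    simpa using h1
  obtain ⟨g, hg⟩ := M.mulVecLin.exists_leftInverse_of_injective hker
  refine ⟨LinearMap.toMatrix' g, ?_⟩
  have h2 := LinearMap.toMatrix'_comp g M.mulVecLin
  rw [hg, ← Matrix.toLin'_apply', LinearMap.toMatrix'_toLin', LinearMap.toMatrix'_id] at h2
  exact h2.symm

/-- Two matrices with the same number of linearly independent columns that factor through each other
differ by an invertible factor. -/
theorem isUnit_of_factor {ι : Type*} [Fintype ι] {k : ℕ} {M₁ M₂ : Matrix ι (Fin k) ℝ}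
    (h₁ : M₁.rank = k) {V V' : Matrix (Fin k) (Fin k) ℝ} (h : M₁ = M₂ * V) (h' : M₂ = M₁ * V') :
    IsUnit V := by
  obtain ⟨N, hN⟩ := exists_mul_eq_one_of_rank_eq M₁ h₁
  have h1 : V' * V = 1 := by
    calc V' * V = N * M₁ * (V' * V) := by rw [hN, Matrix.one_mul]
      _ = N * (M₁ * V' * V) := by simp only [Matrix.mul_assoc]
      _ = 1 := by rw [← h', ← h, hN]
  exact IsUnit.of_mul_eq_one_right _ h1

theorem continuous_mulVec {ι κ : Type*} [Fintype κ] (M : Matrix ι κ ℝ) :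
    Continuous fun v : κ → ℝ => M *ᵥ v :=
  continuous_const.matrix_mulVec continuous_id

theorem eq_and_eq_of_mulVec_add_mulVec_eq {ι κ k : Type*} [Fintype κ] [Fintype k]
    {P P' : Matrix ι κ ℝ} {Q Q' : Matrix ι k ℝ}
    (h : ∀ x g, P *ᵥ x + Q *ᵥ g = P' *ᵥ x + Q' *ᵥ g) : P = P' ∧ Q = Q' := by
  classical
  constructor
  · refine Matrix.ext_of_mulVec_single fun i => ?_
    simpa using h (Pi.single i 1) 0
  · refine Matrix.ext_of_mulVec_single fun i => ?_
    simpa using h 0 (Pi.single i 1)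

namespace ODELTI

/-! ### Trajectories with constant input -/

/-- Local solvability: every initial state and constant input belong to a trajectory on a short
interval `[0, δ]`, and this trajectory is differentiable everywhere on it. -/
theorem exists_isTrajectory_const {ι : Type*} (S : ODELTI ι) (x : Fin S.states → ℝ)
    (g : Fin S.inputs → ℝ) :
    ∃ p : ℝ → Fin S.states → ℝ, ∃ δ > 0, p 0 = x ∧
      (∀ t ∈ Set.Icc 0 δ, HasDerivAt p (S.A *ᵥ p t + S.B *ᵥ g) t) ∧
      S.IsTrajectory (Set.Icc 0 δ) p fun _ => g := by
  have hf : ContDiffAt ℝ 1 (fun y : Fin S.states → ℝ => S.A *ᵥ y + S.B *ᵥ g) x :=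
    ((LinearMap.toContinuousLinearMap S.A.mulVecLin).contDiff.add contDiff_const).contDiffAt
  obtain ⟨p, hp0, ε, hε, hp⟩ :=
    hf.exists_forall_mem_closedBall_exists_eq_forall_mem_Ioo_hasDerivAt₀ 0
  have hd : ∀ t ∈ Set.Icc 0 (ε / 2), HasDerivAt p (S.A *ᵥ p t + S.B *ᵥ g) t := fun t ht =>
    hp t ⟨by linarith [ht.1], by linarith [ht.2]⟩
  refine ⟨p, ε / 2, half_pos hε, hp0, hd, ?_, ?_, ?_⟩
  · have hc : ContinuousOn p (Set.Icc 0 (ε / 2)) := fun t ht =>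
      (hd t ht).continuousAt.continuousWithinAt
    obtain ⟨C, hC⟩ := isCompact_Icc.exists_bound_of_continuousOn
      (((continuous_mulVec S.A).comp_continuousOn hc).add
        (continuousOn_const (c := S.B *ᵥ g)))
    have hL : LipschitzOnWith C.toNNReal p (Set.Icc 0 (ε / 2)) :=
      (convex_Icc _ _).lipschitzOnWith_of_nnnorm_hasDerivWithin_le
        (fun t ht => (hd t ht).hasDerivWithinAt)
        fun t ht => by
          rw [← norm_toNNReal]
          exact Real.toNNReal_le_toNNReal (hC t ht)
    intro a b hab hI
    refine LipschitzOnWith.absolutelyContinuousOnInterval (K := C.toNNReal) ?_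
    rw [Set.uIcc_of_le hab]
    exact hL.mono hI
  · intro a b _ _
    exact integrableOn_const (by simp)
  · filter_upwards [ae_restrict_mem measurableSet_Icc] with t ht
    exact (hd t ht).hasDerivWithinAt

theorem IsTrajectory.continuousOn {ι : Type*} {S : ODELTI ι} {δ : ℝ} (hδ : 0 < δ)
    {p : ℝ → Fin S.states → ℝ} {q : ℝ → Fin S.inputs → ℝ}
    (h : S.IsTrajectory (Set.Icc 0 δ) p q) : ContinuousOn p (Set.Icc 0 δ) := by
  have := (h.ac 0 δ hδ.le subset_rfl).continuousOn
  rwa [Set.uIcc_of_le hδ.le] at this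

/-! ### Comparison of two associated systems -/

variable {c n m : ℕ} {E A : Matrix (Fin c) (Fin n) ℝ} {B : Matrix (Fin c) (Fin m) ℝ}
  {S S₁ S₂ : ODELTI (Fin n ⊕ Fin m)}

/-- The input condition in uniform form: `D` has a generalized inverse `N` for which `B` factors
through `N D`, so `B q` depends on `D q` only. -/
theorem IsAssociated.exists_generalized_inverse (h : S.IsAssociated E A B) :
    ∃ N : Matrix (Fin S.inputs) (Fin n ⊕ Fin m) ℝ,
      S.D * (N * S.D) = S.D ∧ S.B * (N * S.D) = S.B := by
  rcases h.input_cond with ⟨hD, hB, -⟩ | hr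
  · exact ⟨0, by simp [hD], by simp [hB]⟩
  · obtain ⟨N, hN⟩ := exists_mul_eq_one_of_rank_eq _ hr
    exact ⟨N, by simp [hN], by simp [hN]⟩

theorem IsAssociated.mulVec_output (h : S.IsAssociated E A B) (p : ℝ → Fin S.states → ℝ)
    (q : ℝ → Fin S.inputs → ℝ) (t : ℝ) :
    (E *ᵥ fun i => S.output p q t (Sum.inl i)) = (E * S.C.toRows₁) *ᵥ p t := by
  have h1 : (fun i => S.output p q t (Sum.inl i)) =
      S.C.toRows₁ *ᵥ p t + S.D.toRows₁ *ᵥ q t := rfl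
  rw [h1, Matrix.mulVec_add, Matrix.mulVec_mulVec, Matrix.mulVec_mulVec, h.mul_D,
    Matrix.zero_mulVec, add_zero]

/-- Every trajectory of one associated system on `[0, δ]` has the same output as some trajectory of
the other. -/
theorem IsAssociated.exists_output_ae_eq (h₁ : S₁.IsAssociated E A B) (h₂ : S₂.IsAssociated E A B)
    {δ : ℝ} (hδ : 0 < δ) {p : ℝ → Fin S₁.states → ℝ} {q : ℝ → Fin S₁.inputs → ℝ}
    (h : S₁.IsTrajectory (Set.Icc 0 δ) p q) :
    ∃ p₂ q₂, S₂.IsTrajectory (Set.Icc 0 δ) p₂ q₂ ∧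
      S₁.output p q =ᵐ[volume.restrict (Set.Icc 0 δ)] S₂.output p₂ q₂ := by
  have hI : IsTimeInterval (Set.Icc 0 δ) := Or.inr (Or.inr (Or.inr ⟨0, δ, hδ, rfl⟩))
  obtain ⟨z, hz, hz1⟩ := (h₁.realization _ hI).2 p q h
  obtain ⟨p₂, q₂, ht, hz2⟩ := (h₂.realization _ hI).1 z hz
  exact ⟨p₂, q₂, ht, hz1.symm.trans hz2⟩

/-- One associated system factors through another one: the state by `T`, the input by
`(x, g) ↦ W x + V g`. -/
theorem IsAssociated.exists_intertwining (h₁ : S₁.IsAssociated E A B)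
    (h₂ : S₂.IsAssociated E A B) :
    ∃ (T : Matrix (Fin S₂.states) (Fin S₁.states) ℝ)
      (W : Matrix (Fin S₂.inputs) (Fin S₁.states) ℝ)
      (V : Matrix (Fin S₂.inputs) (Fin S₁.inputs) ℝ),
      E * S₁.C.toRows₁ = E * S₂.C.toRows₁ * T ∧
      S₁.C = S₂.C * T + S₂.D * W ∧ S₁.D = S₂.D * V ∧
      T * S₁.A = S₂.A * T + S₂.B * W ∧ T * S₁.B = S₂.B * V := by
  obtain ⟨M, hM⟩ := exists_mul_eq_one_of_rank_eq _ h₂.rank_mul_C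
  obtain ⟨N, hND, hNB⟩ := h₂.exists_generalized_inverse
  set T := M * (E * S₁.C.toRows₁)
  set W := N * (S₁.C - S₂.C * T)
  set V := N * S₁.D
  have key : ∀ (x : Fin S₁.states → ℝ) (g : Fin S₁.inputs → ℝ),
      (E * S₁.C.toRows₁) *ᵥ x = (E * S₂.C.toRows₁ * T) *ᵥ x ∧
      S₁.C *ᵥ x + S₁.D *ᵥ g = (S₂.C * T + S₂.D * W) *ᵥ x + (S₂.D * V) *ᵥ g ∧
      (T * S₁.A) *ᵥ x + (T * S₁.B) *ᵥ g = (S₂.A * T + S₂.B * W) *ᵥ x + (S₂.B * V) *ᵥ g := by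
    intro x g
    obtain ⟨p, δ, hδ, rfl, hd, htr⟩ := S₁.exists_isTrajectory_const x g
    obtain ⟨p₂, q₂, htr₂, hout⟩ := h₁.exists_output_ae_eq h₂ hδ htr
    have hp := htr.continuousOn hδ
    have hp₂ := htr₂.continuousOn hδ
    have h0 : (0 : ℝ) ∈ Set.Icc 0 δ := ⟨le_rfl, hδ.le⟩
    have hc {ι : Type} (P : Matrix ι (Fin S₁.states) ℝ) (b : ι → ℝ) :
        ContinuousOn (fun t => P *ᵥ p t + b) (Set.Icc 0 δ) :=
      ((continuous_mulVec P).comp_continuousOn hp).add continuousOn_const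
    have hF : Set.EqOn (fun t => (E * S₁.C.toRows₁) *ᵥ p t)
        (fun t => (E * S₂.C.toRows₁) *ᵥ p₂ t) (Set.Icc 0 δ) := by
      refine Measure.eqOn_Icc_of_ae_eq volume hδ.ne ?_
        ((continuous_mulVec _).comp_continuousOn hp) ((continuous_mulVec _).comp_continuousOn hp₂)
      filter_upwards [hout] with t ht
      rw [← h₁.mulVec_output p (fun _ => g), ← h₂.mulVec_output p₂ q₂, ht]
    have hTp : Set.EqOn p₂ (fun t => T *ᵥ p t) (Set.Icc 0 δ) := fun t ht => by
      have h1 := congrArg (M *ᵥ ·) (hF ht)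
      simp only [Matrix.mulVec_mulVec, hM, Matrix.one_mulVec] at h1
      exact h1.symm
    -- The equality of outputs determines `D₂ q₂`, and thereby `N D₂ q₂`.
    have hDq : ∀ᵐ t ∂(volume.restrict (Set.Icc 0 δ)),
        S₂.D *ᵥ q₂ t = (S₁.C - S₂.C * T) *ᵥ p t + S₁.D *ᵥ g := by
      filter_upwards [hout, ae_restrict_mem measurableSet_Icc] with t ht htI
      have h1 : S₁.C *ᵥ p t + S₁.D *ᵥ g = S₂.C *ᵥ p₂ t + S₂.D *ᵥ q₂ t := ht
      rw [hTp htI, Matrix.mulVec_mulVec] at h1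
      rw [Matrix.sub_mulVec, sub_add_eq_add_sub, h1, add_sub_cancel_left]
    have hNq : ∀ᵐ t ∂(volume.restrict (Set.Icc 0 δ)),
        (N * S₂.D) *ᵥ q₂ t = W *ᵥ p t + V *ᵥ g := by
      filter_upwards [hDq] with t ht
      rw [← Matrix.mulVec_mulVec, ht, Matrix.mulVec_add, Matrix.mulVec_mulVec,
        Matrix.mulVec_mulVec]
    refine ⟨?_, ?_, ?_⟩
    · exact (hF h0).trans (by simp only [hTp h0, Matrix.mulVec_mulVec])
    · have h1 : Set.EqOn (fun t => S₁.C *ᵥ p t + S₁.D *ᵥ g)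
          (fun t => (S₂.C * T + S₂.D * W) *ᵥ p t + (S₂.D * V) *ᵥ g) (Set.Icc 0 δ) := by
        refine Measure.eqOn_Icc_of_ae_eq volume hδ.ne ?_ (hc _ _) (hc _ _)
        filter_upwards [hDq, hNq] with t ht ht'
        have h2 := congrArg (S₂.D *ᵥ ·) ht'
        simp only [Matrix.mulVec_mulVec, hND, Matrix.mulVec_add] at h2
        rw [ht, Matrix.sub_mulVec, sub_add_eq_add_sub, sub_eq_iff_eq_add] at h2
        rw [h2, Matrix.add_mulVec]
        abel
      exact h1 h0
    · have h1 : Set.EqOn (fun t => (T * S₁.A) *ᵥ p t + (T * S₁.B) *ᵥ g)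
          (fun t => (S₂.A * T + S₂.B * W) *ᵥ p t + (S₂.B * V) *ᵥ g) (Set.Icc 0 δ) := by
        refine Measure.eqOn_Icc_of_ae_eq volume hδ.ne ?_ (hc _ _) (hc _ _)
        filter_upwards [hNq, htr₂.deriv, ae_restrict_mem measurableSet_Icc] with t ht hdt htI
        -- Both sides are the derivative of `p₂ = T p` at `t`.
        have h2 : HasDerivWithinAt p₂ (T *ᵥ (S₁.A *ᵥ p t + S₁.B *ᵥ g)) (Set.Icc 0 δ) t := by
          have h3 : HasDerivAt (fun s => T *ᵥ p s) (T *ᵥ (S₁.A *ᵥ p t + S₁.B *ᵥ g)) t :=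
            (LinearMap.toContinuousLinearMap T.mulVecLin).hasFDerivAt.comp_hasDerivAt t (hd t htI)
          exact h3.hasDerivWithinAt.congr hTp (hTp htI)
        have h4 := (uniqueDiffOn_Icc hδ t htI).eq_deriv _ h2 hdt
        have h5 := congrArg (S₂.B *ᵥ ·) ht
        simp only [Matrix.mulVec_mulVec, hNB, Matrix.mulVec_add] at h5
        rw [Matrix.mulVec_add, Matrix.mulVec_mulVec, Matrix.mulVec_mulVec, h5, hTp htI,
          Matrix.mulVec_mulVec] at h4
        rw [h4, Matrix.add_mulVec, add_assoc]
      exact h1 h0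
  obtain ⟨hC, hD⟩ : S₁.C = S₂.C * T + S₂.D * W ∧ S₁.D = S₂.D * V :=
    eq_and_eq_of_mulVec_add_mulVec_eq fun x g => (key x g).2.1
  obtain ⟨hA, hB⟩ : T * S₁.A = S₂.A * T + S₂.B * W ∧ T * S₁.B = S₂.B * V :=
    eq_and_eq_of_mulVec_add_mulVec_eq fun x g => (key x g).2.2
  exact ⟨T, W, V, Matrix.ext_of_mulVec_single fun i => (key (Pi.single i 1) 0).1, hC, hD, hA, hB⟩

theorem IsAssociated.states_le_states (h₁ : S₁.IsAssociated E A B) (h₂ : S₂.IsAssociated E A B) :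
    S₁.states ≤ S₂.states := by
  obtain ⟨T, -, -, hF, -⟩ := h₁.exists_intertwining h₂
  rw [← h₁.rank_mul_C, ← h₂.rank_mul_C, hF]
  exact Matrix.rank_mul_le_left _ _

/-- The two alternatives of the input condition cannot be mixed: the column spaces of the matrices
`D` of two associated systems coincide. -/
theorem IsAssociated.input_cond_pair (h₁ : S₁.IsAssociated E A B) (h₂ : S₂.IsAssociated E A B) :
    (S₁.D = 0 ∧ S₁.B = 0 ∧ S₂.D = 0 ∧ S₂.B = 0 ∧ S₁.inputs = S₂.inputs) ∨
      (S₁.D.rank = S₁.inputs ∧ S₁.inputs = S₂.inputs) := by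
  obtain ⟨-, -, V, -, -, hV, -⟩ := h₁.exists_intertwining h₂
  obtain ⟨-, -, V', -, -, hV', -⟩ := h₂.exists_intertwining h₁
  have hr : S₁.D.rank = S₂.D.rank :=
    le_antisymm (hV ▸ Matrix.rank_mul_le_left _ _) (hV' ▸ Matrix.rank_mul_le_left _ _)
  have k₁ := h₁.inputs_pos
  have k₂ := h₂.inputs_pos
  rcases h₁.input_cond with ⟨hD₁, hB₁, hi₁⟩ | hr₁ <;>
    rcases h₂.input_cond with ⟨hD₂, hB₂, hi₂⟩ | hr₂
  · exact Or.inl ⟨hD₁, hB₁, hD₂, hB₂, hi₁.trans hi₂.symm⟩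
  · rw [hD₁, Matrix.rank_zero] at hr
    omega
  · rw [hD₂, Matrix.rank_zero] at hr
    omega
  · exact Or.inr ⟨hr₁, by omega⟩

/-! ### From intertwining relations to feedback equivalence -/

/-- Two systems of equal size that satisfy the intertwining relations with invertible `T` and `V`
are feedback equivalent. -/
theorem feedbackEquivalent_of_intertwining {ι : Type*} {s k : ℕ}
    {A₁ A₂ : Matrix (Fin s) (Fin s) ℝ} {B₁ B₂ : Matrix (Fin s) (Fin k) ℝ}
    {C₁ C₂ : Matrix ι (Fin s) ℝ} {D₁ D₂ : Matrix ι (Fin k) ℝ}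
    {T : Matrix (Fin s) (Fin s) ℝ} {W : Matrix (Fin k) (Fin s) ℝ} {V : Matrix (Fin k) (Fin k) ℝ}
    (hT : IsUnit T) (hV : IsUnit V) (hC : C₁ = C₂ * T + D₂ * W) (hD : D₁ = D₂ * V)
    (hA : T * A₁ = A₂ * T + B₂ * W) (hB : T * B₁ = B₂ * V) :
    FeedbackEquivalent (⟨s, k, A₁, B₁, C₁, D₁⟩ : ODELTI ι) ⟨s, k, A₂, B₂, C₂, D₂⟩ := by
  have hT' := (Matrix.isUnit_iff_isUnit_det _).1 hT
  have hV' := (Matrix.isUnit_iff_isUnit_det _).1 hV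
  refine ⟨T, -(V⁻¹ * W), V⁻¹, hT, (Matrix.isUnit_nonsing_inv_iff).2 hV, ?_⟩
  have eB : T * B₁ * V⁻¹ = B₂ := by rw [hB, Matrix.mul_nonsing_inv_cancel_right _ _ hV']
  have eD : D₁ * V⁻¹ = D₂ := by rw [hD, Matrix.mul_nonsing_inv_cancel_right _ _ hV']
  have eA : T * (A₁ + B₁ * -(V⁻¹ * W)) * T⁻¹ = A₂ := by
    have : T * (A₁ + B₁ * -(V⁻¹ * W)) = A₂ * T := by
      rw [Matrix.mul_add, hA, Matrix.mul_neg, Matrix.mul_neg, ← Matrix.mul_assoc B₁,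
        ← Matrix.mul_assoc T, ← Matrix.mul_assoc T, eB, add_neg_cancel_right]
    rw [this, Matrix.mul_nonsing_inv_cancel_right _ _ hT']
  have eC : (C₁ + D₁ * -(V⁻¹ * W)) * T⁻¹ = C₂ := by
    rw [Matrix.mul_neg, ← Matrix.mul_assoc D₁, eD, hC, add_neg_cancel_right,
      Matrix.mul_nonsing_inv_cancel_right _ _ hT']
  rw [eA, eB, eC, eD]

end ODELTI

end DAELTI

theorem mainTheorem3 {c n m : ℕ}
    (E A : Matrix (Fin c) (Fin n) ℝ) (B : Matrix (Fin c) (Fin m) ℝ)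
    (S₁ S₂ : DAELTI.ODELTI (Fin n ⊕ Fin m))
    (h₁ : S₁.IsAssociated E A B) (h₂ : S₂.IsAssociated E A B) :
    S₁.FeedbackEquivalent S₂ := by
  have hs : S₁.states = S₂.states :=
    le_antisymm (h₁.states_le_states h₂) (h₂.states_le_states h₁)
  have hin := h₁.input_cond_pair h₂
  have hk : S₁.inputs = S₂.inputs := by
    rcases hin with ⟨-, -, -, -, h⟩ | ⟨-, h⟩ <;> exact h
  obtain ⟨T, W, V, hF, hC, hD, hA, hB⟩ := h₁.exists_intertwining h₂
  obtain ⟨T', -, V', hF', -, hD', -, -⟩ := h₂.exists_intertwining h₁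
  have hr := h₁.rank_mul_C
  clear h₁ h₂
  obtain ⟨s₁, k₁, A₁, B₁, C₁, D₁⟩ := S₁
  obtain ⟨s₂, k₂, A₂, B₂, C₂, D₂⟩ := S₂
  dsimp only at *
  subst hs hk
  have hT : IsUnit T := DAELTI.isUnit_of_factor hr hF hF'
  rcases hin with ⟨d₁, b₁, d₂, b₂, -⟩ | ⟨hrD, -⟩
  · -- Here `V` and `W` are irrelevant, since they only occur multiplied by `0`.
    exact DAELTI.ODELTI.feedbackEquivalent_of_intertwining (W := 0) hT isUnit_one
      (by simpa [d₂] using hC) (by simp [d₁, d₂])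
      (by simpa [b₂] using hA) (by simp [b₁, b₂])
  · exact DAELTI.ODELTI.feedbackEquivalent_of_intertwining hT
      (DAELTI.isUnit_of_factor hrD hD hD') hC hD hA hB
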